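/- Manifolds are finite-dimensional of class $C^\infty$ and Hausdorff. An *étale map* is a local diffeomorphism. Let $\mathcal M_n$ be the category of $n$-dimensional manifolds and étale maps. **Étale structures.** A *chart* on a set $X$ is a map of sets $k:D(k)\to X$ whose domain $D(k)$ is an $n$-manifold; a morphism of charts $k_1\to k_2$ is an étale map $f:D(k_1)\to D(k_2)$ with $k_1=k_2\circ f$. An *étale structure* on $X$ consists of a family $\Phi$ of charts on $X$, a category $\mathcal E$ with object set $\Phi$, a subcategory $\mathcal B$ of the category of charts with object set $\Phi$, and a full functor $\Pi:\mathcal E\to\mathcal B$, identical on objects, such that $X$ with the maps $k:D(k)\to X$ ($k\in\Phi$) is the inductive limit of the functor $\mathcal E\to\mathrm{Sets}$, $k\mapsto D(k)$, $f\mapsto\Pi(f)$. It is *locally invertible* if for every $\mathcal E$-morphism $f:k_1\to k_2$ and every $x\in D(k_1)$ there are $k_3\in\Phi$, with $D(k_3)$ (identified by a diffeomorphism with) an open submanifold of $D(k_2)$ containing $f(x)$, and an $\mathcal E$-morphism $g:k_3\to k_1$ such that $g(f(x))=x$ and $f\circ g=1_{D(k_3)}$. **The category $\mathcal E(\mathcal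 G)$.** Let $\mathcal G$ be a smooth groupoid: a groupoid whose set of objects $\mathcal G_0$ is an $n$-manifold and whose set of arrows $\mathcal G_1$ is an $m$-manifold (not necessarily Hausdorff), whose structure maps (source $s$, target $t$, unit, inverse, multiplication) are smooth, and for which $s$ and $t$ are submersions. Let $p:\mathcal G_0\to X=\mathcal G_0/\!\sim$ be the projection onto the orbit set. The objects of $\mathcal E(\mathcal G)$ are the open sets $U\subset\mathcal G_0$; a morphism $U\to V$ is a smooth section $\sigma:U\to\mathcal G_1$ of $s$ such that $f_\sigma=t\circ\sigma$ maps $U$ into $V$ and is étale; composition is $(\tau\sigma)(x)=\tau(f_\sigma(x))\cdot\sigma(x)$. To $U$ one associates the chart $k_U=p|_U:U\to X$, to $\sigma:U\to V$ the étale map $f_\sigma:k_U\to k_V$; $\mathcal B(\mathcal G)$ is the category with objects the charts $k_U$ and morphisms these étale maps $f_\sigma$, and $\Pi:\mathcal E(\mathcal G)\to\mathcal B(\mathcal G)$ is the functor $U\mapsto k_U$, $\sigma\mapsto f_\sigma$. **Proposition.** For every smooth groupoid $\mathcal G$, the category $\mathcal E(\mathcal G)$, with $\Pi:\mathcal E(\mathcal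 G)\to\mathcal B(\mathcal G)$, is a locally invertible étale structure on $X=\mathcal G_0/\!\sim$. Moreover, for each $g\in\mathcal G_1$ there is a morphism $\sigma$ of $\mathcal E(\mathcal G)$, defined on a neighbourhood of $s(g)$, with $\sigma(s(g))=g$; and if $\mathcal G$ is étale (that is, $s$ is étale), every smooth section $\sigma:U\to\mathcal G_1$ of $s$ with $t(\sigma(U))\subset V$ is a morphism $U\to V$ of $\mathcal E(\mathcal G)$. -/

import Mathlib

open CategoryTheory CategoryTheory.Limits TopologicalSpace
open scoped Manifold ContDiff

universe u v w w'

/-! ## The category of `n`-manifolds and étale maps -/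

/-- A smooth Hausdorff manifold of dimension `n` (second countability is not required). -/
structure EtMan (n : ℕ) : Type (u + 1) where
  carrier : Type u
  [top : TopologicalSpace carrier]
  [charted : ChartedSpace (EuclideanSpace ℝ (Fin n)) carrier]
  [smooth : IsManifold (𝓡 n) ∞ carrier]
  [t2 : T2Space carrier]

namespace EtMan

attribute [instance] EtMan.top EtMan.charted EtMan.smooth EtMan.t2

variable {n : ℕ}

/-- An étale map: a local diffeomorphism of class `C^∞`. -/
@[ext]
structure Hom (M N : EtMan.{u} n) : Type u where
  toFun : M.carrier → N.carrier
  etale : IsLocalDiffeomorph (𝓡 n) (𝓡 n) ∞ toFun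

theorem isLocalDiffeomorph_id (M : EtMan.{u} n) :
    IsLocalDiffeomorph (𝓡 n) (𝓡 n) ∞ (id : M.carrier → M.carrier) :=
  (Diffeomorph.refl (𝓡 n) M.carrier ∞).isLocalDiffeomorph

/-- The category of `n`-dimensional manifolds and étale maps. -/
instance : Category.{u} (EtMan.{u} n) where
  Hom := Hom
  id M := ⟨id, M.isLocalDiffeomorph_id⟩
  comp f g := ⟨g.toFun ∘ f.toFun, fun x => (f.etale x).comp (K := 𝓡 n) (hg := g.etale (f.toFun x))⟩

/-- The forgetful functor to sets. -/
def forget (n : ℕ) : EtMan.{u} n ⥤ Type u where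
  obj M := M.carrier
  map f := TypeCat.ofHom f.toFun

end EtMan

/-! ## Charts on a set and étale structures -/

/-- The category of charts on a set `X`: an object is a map `k : D(k) → X` of sets whose domain
`D(k)` is an `n`-manifold, a morphism `k₁ ⟶ k₂` is an étale map `f : D(k₁) → D(k₂)` with
`k₁ = k₂ ∘ f`. -/
abbrev ManChart (n : ℕ) (X : Type u) := CostructuredArrow (EtMan.forget.{u} n) X

section EtaleStructure

variable {n : ℕ} {X : Type u} {E : Type w} [Category.{w'} E]

/-- `ChartFamily k` is the full subcategory `C_Φ` of the category of charts on `X` whose objects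
are the charts of the family `k`. -/
abbrev ChartFamily (k : E → ManChart n X) := InducedCategory (ManChart n X) k

variable {k : E → ManChart n X} {B : MorphismProperty (ChartFamily k)} [B.IsMultiplicative]

/-- The composite `D ∘ Π`, for a functor `Π` to a subcategory `B` of the category of charts. -/
noncomputable def domainFunctor (P : E ⥤ WideSubcategory B) : E ⥤ EtMan.{u} n :=
  P ⋙ wideSubcategoryInclusion B ⋙ inducedFunctor k ⋙ CostructuredArrow.proj _ _

/-- The cocone under the functor `J ∘ D ∘ Π : E ⥤ Sets` with vertex `X` given by the charts
`k : D(k) → X` themselves. -/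
noncomputable def chartCocone (P : E ⥤ WideSubcategory B) : Cocone (domainFunctor P ⋙ EtMan.forget.{u} n) where
  pt := X
  ι :=
    { app := fun a => (k (P.obj a).obj).hom
      naturality := fun _ _ f => by
        have h := CostructuredArrow.w ((P.map f).hom.hom)
        exact h.trans (Category.comp_id _).symm }

/-- Étale structures on the set `X`.  The set `Φ` of charts is given as a family `k`, indexed by
the objects of the category `E`; `B` is a subcategory of the category of these charts with all of
them as objects; `P : E ⥤ B` is a full functor which is the identity on objects; and the maps
`k : D(k) → X` make `X` the inductive limit of the domains of the charts over `E`. -/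
structure IsEtaleStructure (k : E → ManChart n X) (B : MorphismProperty (ChartFamily k))
    [B.IsMultiplicative] (P : E ⥤ WideSubcategory B) : Prop where
  obj_eq : ∀ a : E, (P.obj a).obj = a
  full : P.Full
  isColimit : Nonempty (IsColimit (chartCocone P))

/-- Local invertibility: for each morphism `f : k₁ ⟶ k₂` of `E` and each `x ∈ D(k₁)` there is a
morphism `g : k₃ ⟶ k₁` of `E`, where `D(k₃)` is (identified by the diffeomorphism `e` with) an open
submanifold `W` of `D(k₂)` that contains `f(x)`, with `g(f(x)) = x` and `f ∘ g` the identity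
of `D(k₃)`. -/
def IsLocallyInvertible (P : E ⥤ WideSubcategory B) : Prop :=
  ∀ ⦃k₁ k₂ : E⦄ (f : k₁ ⟶ k₂) (x : ((domainFunctor P).obj k₁).carrier),
    ∃ (k₃ : E) (g : k₃ ⟶ k₁) (W : Opens ((domainFunctor P).obj k₂).carrier)
      (e : Diffeomorph (𝓡 n) (𝓡 n) ((domainFunctor P).obj k₃).carrier W ∞)
      (y : ((domainFunctor P).obj k₃).carrier),
      (e y : ((domainFunctor P).obj k₂).carrier) = ((domainFunctor P).map f).toFun x ∧
      ((domainFunctor P).map g).toFun y = x ∧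
      ∀ z, ((domainFunctor P).map f).toFun (((domainFunctor P).map g).toFun z) = e z

end EtaleStructure

/-! ## Smooth groupoids -/

/-- A smooth groupoid with manifold of objects `G₀` (of dimension `n`) and manifold of arrows `G₁`
(of dimension `m`).  The product `mul f g` is meaningful only for composable pairs, `s f = t g`;
its values at other pairs are irrelevant.  It is smooth on the set of composable pairs, a
submanifold of `G₁ × G₁`. -/
structure SmoothGroupoid (n m : ℕ) (G₀ : Type u) (G₁ : Type v)
    [TopologicalSpace G₀] [ChartedSpace (EuclideanSpace ℝ (Fin n)) G₀]
    [TopologicalSpace G₁] [ChartedSpace (EuclideanSpace ℝ (Fin m)) G₁] where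
  s : G₁ → G₀
  t : G₁ → G₀
  one : G₀ → G₁
  inv : G₁ → G₁
  mul : G₁ → G₁ → G₁
  s_one : ∀ x, s (one x) = x
  t_one : ∀ x, t (one x) = x
  s_inv : ∀ f, s (inv f) = t f
  t_inv : ∀ f, t (inv f) = s f
  s_mul : ∀ f g, s f = t g → s (mul f g) = s g
  t_mul : ∀ f g, s f = t g → t (mul f g) = t f
  mul_assoc : ∀ f g h, s f = t g → s g = t h → mul (mul f g) h = mul f (mul g h)
  mul_one : ∀ f, mul f (one (s f)) = f
  one_mul : ∀ f, mul (one (t f)) f = f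
  mul_inv : ∀ f, mul f (inv f) = one (t f)
  inv_mul : ∀ f, mul (inv f) f = one (s f)
  submersion_s : Manifold.IsSubmersion (𝓡 m) (𝓡 n) ∞ s
  submersion_t : Manifold.IsSubmersion (𝓡 m) (𝓡 n) ∞ t
  smooth_one : ContMDiff (𝓡 n) (𝓡 m) ∞ one
  smooth_inv : ContMDiff (𝓡 m) (𝓡 m) ∞ inv
  smooth_mul : ContMDiffOn ((𝓡 m).prod (𝓡 m)) (𝓡 m) ∞
    (fun p : G₁ × G₁ => mul p.1 p.2) {p | s p.1 = t p.2}

namespace SmoothGroupoid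

variable {n m : ℕ} {G₀ : Type u} {G₁ : Type v}
  [TopologicalSpace G₀] [ChartedSpace (EuclideanSpace ℝ (Fin n)) G₀]
  [TopologicalSpace G₁] [ChartedSpace (EuclideanSpace ℝ (Fin m)) G₁]

/-- The orbit set: the quotient of `G₀` by the equivalence relation generated by `x ∼ y` whenever
there is an arrow `x → y`. -/
def Orbits (G : SmoothGroupoid n m G₀ G₁) : Type u :=
  Quot (fun x y : G₀ => ∃ g, G.s g = x ∧ G.t g = y)

/-- The projection `G₀ → G₀/∼`. -/
def toOrbits (G : SmoothGroupoid n m G₀ G₁) (x : G₀) : G.Orbits := Quot.mk _ x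

/-- The objects of the category `E(G)`: the open subsets of `G₀`. -/
structure EObj (_G : SmoothGroupoid n m G₀ G₁) : Type u where
  opens : Opens G₀

/-- The morphisms `U → V` of the category `E(G)`: smooth local sections `σ : U → G₁` of the source
map such that `t ∘ σ` maps `U` into `V` and is an étale map. -/
@[ext]
structure EHom (G : SmoothGroupoid n m G₀ G₁) (U V : G.EObj) : Type (max u v) where
  toFun : U.opens → G₁
  smooth : ContMDiff (𝓡 n) (𝓡 m) ∞ toFun
  source_eq : ∀ x, G.s (toFun x) = x
  target_mem : ∀ x, G.t (toFun x) ∈ V.opens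
  etale : IsLocalDiffeomorph (𝓡 n) (𝓡 n) ∞
    (fun x : U.opens => (⟨G.t (toFun x), target_mem x⟩ : V.opens))

/-- The étale map `t ∘ σ : U → V` of a morphism `σ`. -/
def EHom.map {G : SmoothGroupoid n m G₀ G₁} {U V : G.EObj} (σ : G.EHom U V) :
    U.opens → V.opens :=
  fun x => ⟨G.t (σ.toFun x), σ.target_mem x⟩

/-- The identity of `U`: the section `x ↦ 1_x`. -/
def idHom (G : SmoothGroupoid n m G₀ G₁) (U : G.EObj) : G.EHom U U where
  toFun x := G.one x
  smooth := G.smooth_one.comp contMDiff_subtype_val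
  source_eq x := G.s_one x
  target_mem x := by rw [G.t_one]; exact x.2
  etale := by
    have h : (fun x : U.opens => (⟨G.t (G.one x), by rw [G.t_one]; exact x.2⟩ : U.opens)) = id :=
      funext fun x => Subtype.ext (G.t_one x)
    rw [h]
    exact (Diffeomorph.refl (𝓡 n) U.opens ∞).isLocalDiffeomorph

/-- The composition of `σ : U → V` and `τ : V → W`: the section `x ↦ τ(t(σ(x))) · σ(x)`. -/
def compHom (G : SmoothGroupoid n m G₀ G₁) {U V W : G.EObj} (σ : G.EHom U V) (τ : G.EHom V W) :
    G.EHom U W where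
  toFun x := G.mul (τ.toFun (σ.map x)) (σ.toFun x)
  smooth := by
    have h₁ : ContMDiff (𝓡 n) (𝓡 m) ∞ (fun x => τ.toFun (σ.map x)) :=
      τ.smooth.comp (IsLocalDiffeomorph.contMDiff σ.etale)
    have h₂ := h₁.prodMk σ.smooth
    exact G.smooth_mul.comp_contMDiff h₂ (fun x => τ.source_eq (σ.map x))
  source_eq x := by
    rw [G.s_mul _ _ (τ.source_eq (σ.map x))]
    exact σ.source_eq x
  target_mem x := by
    rw [G.t_mul _ _ (τ.source_eq (σ.map x))]
    exact τ.target_mem _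
  etale := by
    have h : (fun x : U.opens => (⟨G.t (G.mul (τ.toFun (σ.map x)) (σ.toFun x)), by
        rw [G.t_mul _ _ (τ.source_eq (σ.map x))]; exact τ.target_mem _⟩ : W.opens)) =
        τ.map ∘ σ.map :=
      funext fun x => Subtype.ext (G.t_mul _ _ (τ.source_eq (σ.map x)))
    rw [h]
    exact fun x => (σ.etale x).comp (K := 𝓡 n) (hg := τ.etale (σ.map x))

theorem id_map (G : SmoothGroupoid n m G₀ G₁) (U : G.EObj) (x : U.opens) :
    (G.idHom U).map x = x :=
  Subtype.ext (G.t_one x)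

theorem comp_map (G : SmoothGroupoid n m G₀ G₁) {U V W : G.EObj} (σ : G.EHom U V)
    (τ : G.EHom V W) (x : U.opens) : (G.compHom σ τ).map x = τ.map (σ.map x) :=
  Subtype.ext (G.t_mul _ _ (τ.source_eq (σ.map x)))

/-- The category `E(G)`. -/
instance (G : SmoothGroupoid n m G₀ G₁) : Category.{max u v} G.EObj where
  Hom U V := G.EHom U V
  id U := G.idHom U
  comp σ τ := G.compHom σ τ
  id_comp {U V} σ := by
    refine EHom.ext (funext fun x => ?_)
    have hx : (G.idHom U).map x = x := Subtype.ext (G.t_one x)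
    change G.mul (σ.toFun ((G.idHom U).map x)) (G.one x) = σ.toFun x
    rw [hx]
    have h := G.mul_one (σ.toFun x)
    rwa [σ.source_eq x] at h
  comp_id {U V} σ := EHom.ext (funext fun x => G.one_mul (σ.toFun x))
  assoc {U V W Z} σ τ ρ := by
    refine EHom.ext (funext fun x => ?_)
    have hx : (G.compHom σ τ).map x = τ.map (σ.map x) :=
      Subtype.ext (G.t_mul _ _ (τ.source_eq (σ.map x)))
    change G.mul (ρ.toFun ((G.compHom σ τ).map x)) (G.mul (τ.toFun (σ.map x)) (σ.toFun x)) =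
      G.mul (G.mul (ρ.toFun (τ.map (σ.map x))) (τ.toFun (σ.map x))) (σ.toFun x)
    rw [hx]
    exact (G.mul_assoc _ _ _ (ρ.source_eq _) (τ.source_eq _)).symm

section Charts

variable [IsManifold (𝓡 n) ∞ G₀] [T2Space G₀]

/-- The open subset `U` of `G₀` as an `n`-manifold. -/
noncomputable def man (G : SmoothGroupoid n m G₀ G₁) (U : G.EObj) : EtMan.{u} n := ⟨U.opens⟩

/-- The chart `k_U`: the restriction to `U` of the projection `G₀ → G₀/∼`. -/
noncomputable def chart (G : SmoothGroupoid n m G₀ G₁) (U : G.EObj) : ManChart n G.Orbits :=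
  CostructuredArrow.mk (S := EtMan.forget.{u} n) (Y := G.man U)
    (TypeCat.ofHom (fun x : U.opens => G.toOrbits x))

/-- The étale map `t ∘ σ`, as a morphism of charts `k_U ⟶ k_V`. -/
noncomputable def chartMap (G : SmoothGroupoid n m G₀ G₁) {U V : G.EObj} (σ : U ⟶ V) :
    G.chart U ⟶ G.chart V :=
  CostructuredArrow.homMk (⟨EHom.map σ, EHom.etale σ⟩ : EtMan.Hom (G.man U) (G.man V)) (by
    refine ConcreteCategory.hom_ext _ _ (fun x => ?_)
    exact (Quot.sound ⟨EHom.toFun σ x, EHom.source_eq σ x, rfl⟩).symm)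

/-- The morphisms of the category `B(G)`, whose objects are the charts `k_U`: the étale maps
`t ∘ σ : k_U ⟶ k_V`, for the morphisms `σ` of `E(G)`. -/
def etaleMaps (G : SmoothGroupoid n m G₀ G₁) : MorphismProperty (ChartFamily G.chart) :=
  fun U V φ => ∃ σ : G.EHom U V, ∀ x : U.opens, φ.hom.left.toFun x = σ.map x

instance (G : SmoothGroupoid n m G₀ G₁) : G.etaleMaps.IsMultiplicative where
  id_mem U := ⟨G.idHom U, fun x => (G.id_map U x).symm⟩
  comp_mem {U V W} f g hf hg := by
    obtain ⟨σ, hσ⟩ := hf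
    obtain ⟨τ, hτ⟩ := hg
    refine ⟨G.compHom σ τ, fun x => ?_⟩
    rw [G.comp_map, ← hσ x]
    exact hτ _

/-- The functor `Π : E(G) ⥤ B(G)`, `U ↦ k_U`, `σ ↦ t ∘ σ`. -/
noncomputable def proj (G : SmoothGroupoid n m G₀ G₁) : G.EObj ⥤ WideSubcategory G.etaleMaps where
  obj U := ⟨U⟩
  map σ := ⟨⟨G.chartMap σ⟩, σ, fun _ => rfl⟩
  map_id U := by
    refine WideSubcategory.hom_ext _ (InducedCategory.hom_ext ?_)
    refine CostructuredArrow.hom_ext _ _ (EtMan.Hom.ext (funext fun x => ?_))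
    exact G.id_map U x
  map_comp σ τ := by
    refine WideSubcategory.hom_ext _ (InducedCategory.hom_ext ?_)
    refine CostructuredArrow.hom_ext _ _ (EtMan.Hom.ext (funext fun x => ?_))
    exact G.comp_map σ τ x

end Charts

end SmoothGroupoid

/-! The heart of the matter is that through every arrow g passes a local section σ of s for which t
∘ σ is étale near s(g) (`exists_eHom_through`). In coordinates where s is the projection (u, v) ↦ u,
try v = v₀ + A(u - u₀) with A linear. If S and T are the partial derivatives of t in u and v, then t
∘ σ has derivative S + TA. As t is a submersion, (S, T) is surjective, and the u-space has the
dimension of the target, so some A makes S + TA bijective (`LinearMap.exists_bijective_add_comp`);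
the inverse function theorem does the rest.

The colimit property follows. The inclusions x ↦ 1_x are morphisms, so a cocone is determined by its
component on all of G₀; the section through g shows that this component agrees at s(g) and t(g), so
it descends uniquely to the orbits. Local inverses are z ↦ σ(ρ(z))⁻¹, with ρ a local inverse of t ∘
σ. If s is étale, a section of s is locally an inverse of s, and t = s ∘ inv is étale too. -/

/-! ### Local diffeomorphisms and open submanifolds. -/

section LocalDiffeomorph

open Set Filter Topology

variable {𝕜 : Type*} [NontriviallyNormedField 𝕜]
  {E : Type*} [NormedAddCommGroup E] [NormedSpace 𝕜 E]
  {F : Type*} [NormedAddCommGroup F] [NormedSpace 𝕜 F]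
  {H H' : Type*} [TopologicalSpace H] [TopologicalSpace H']
  {I : ModelWithCorners 𝕜 E H} {J : ModelWithCorners 𝕜 F H'}
  {M : Type*} [TopologicalSpace M] [ChartedSpace H M]
  {N : Type*} [TopologicalSpace N] [ChartedSpace H' N]
  {k : WithTop ℕ∞}

/-- The restriction of a partial diffeomorphism to an open subset of its source. -/
def PartialDiffeomorph.restrOpen (Φ : PartialDiffeomorph I J M N k) (s : Set M) (hs : IsOpen s) :
    PartialDiffeomorph I J M N k where
  __ := Φ.toOpenPartialHomeomorph.restrOpen s hs
  contMDiffOn_toFun := Φ.contMDiffOn_toFun.mono inter_subset_left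
  contMDiffOn_invFun := Φ.contMDiffOn_invFun.mono inter_subset_left

/-- A chart in the maximal atlas is a local diffeomorphism. -/
theorem OpenPartialHomeomorph.isLocalDiffeomorphAt_of_mem_maximalAtlas
    {M : Type*} [TopologicalSpace M] [ChartedSpace E M] [IsManifold 𝓘(𝕜, E) k M]
    {φ : OpenPartialHomeomorph M E}
    (h : φ ∈ IsManifold.maximalAtlas 𝓘(𝕜, E) k M) {x : M} (hx : x ∈ φ.source) :
    IsLocalDiffeomorphAt 𝓘(𝕜, E) 𝓘(𝕜, E) k φ x :=
  ⟨{ toPartialEquiv := φ.toPartialEquiv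
     open_source := φ.open_source
     open_target := φ.open_target
     contMDiffOn_toFun := contMDiffOn_of_mem_maximalAtlas h
     contMDiffOn_invFun := contMDiffOn_symm_of_mem_maximalAtlas h }, hx, fun _ _ => rfl⟩

namespace IsLocalDiffeomorphAt

variable {f g : M → N} {x : M}

theorem congr_of_eventuallyEq (hf : IsLocalDiffeomorphAt I J k f x) (h : g =ᶠ[𝓝 x] f) :
    IsLocalDiffeomorphAt I J k g x := by
  obtain ⟨Φ, hx, hΦ⟩ := hf
  obtain ⟨s, hs, hso, hxs⟩ := mem_nhds_iff.mp h
  exact ⟨Φ.restrOpen s hso, ⟨hx, hxs⟩, fun y hy => (hs hy.2).trans (hΦ hy.1)⟩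

theorem eventually (hf : IsLocalDiffeomorphAt I J k f x) :
    ∀ᶠ y in 𝓝 x, IsLocalDiffeomorphAt I J k f y := by
  obtain ⟨Φ, hx, hΦ⟩ := hf
  filter_upwards [Φ.open_source.mem_nhds hx] with y hy using ⟨Φ, hy, hΦ⟩

/-- A local diffeomorphism is locally injective. -/
theorem eventually_eq_of_apply_eq (hf : IsLocalDiffeomorphAt I J k f x) :
    ∃ s ∈ 𝓝 x, ∀ y ∈ s, ∀ z ∈ s, f y = f z → y = z := by
  obtain ⟨Φ, hx, hΦ⟩ := hf
  refine ⟨_, Φ.open_source.mem_nhds hx, fun y hy z hz h => Φ.injOn hy hz ?_⟩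
  exact (hΦ hy).symm.trans (h.trans (hΦ hz))

/-- A continuous local right inverse of a local diffeomorphism is a local diffeomorphism. -/
theorem of_rightInverse (hf : IsLocalDiffeomorphAt I J k f x) {σ : N → M}
    (hσx : σ (f x) = x) (hσ : ContinuousAt σ (f x)) (h : ∀ᶠ y in 𝓝 (f x), f (σ y) = y) :
    IsLocalDiffeomorphAt J I k σ (f x) := by
  refine hf.localInverse_isLocalDiffeomorphAt.congr_of_eventuallyEq ?_
  -- Continuity keeps σ on the sheet through x, where the local inverse undoes f.
  have ht : hf.localInverse.target ∈ 𝓝 (σ (f x)) := by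
    rw [hσx]
    exact hf.localInverse.open_target.mem_nhds hf.localInverse_mem_target
  filter_upwards [h, hσ.preimage_mem_nhds ht] with y hy hy'
  rw [← hf.localInverse_left_inv hy', hy]

end IsLocalDiffeomorphAt

namespace TopologicalSpace.Opens

/-- The inclusion of a nonempty open subset as a partial diffeomorphism. -/
noncomputable def partialDiffeomorphSubtypeVal (U : Opens M) (x₀ : U) :
    PartialDiffeomorph I I U M k where
  toPartialEquiv := (U.openPartialHomeomorphSubtypeCoe ⟨x₀⟩).toPartialEquiv
  open_source := (U.openPartialHomeomorphSubtypeCoe ⟨x₀⟩).open_source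
  open_target := (U.openPartialHomeomorphSubtypeCoe ⟨x₀⟩).open_target
  contMDiffOn_toFun := contMDiff_subtype_val.contMDiffOn
  contMDiffOn_invFun y hy := by
    have hy' : y ∈ U := by simpa using hy
    refine ContMDiffAt.contMDiffWithinAt ?_
    -- Smoothness at y may be tested after composing with the inclusion of U, and that composite is
    -- the identity.
    refine (contMDiffAt_subtype_iff (x := (⟨y, hy'⟩ : U))).mp ?_
    refine contMDiffAt_id.congr_of_eventuallyEq (Eventually.of_forall fun z => ?_)
    exact (U.openPartialHomeomorphSubtypeCoe ⟨x₀⟩).left_inv (by simp)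

theorem isLocalDiffeomorph_subtype_val (U : Opens M) :
    IsLocalDiffeomorph I I k (Subtype.val : U → M) :=
  fun x => ⟨U.partialDiffeomorphSubtypeVal x, by simp [partialDiffeomorphSubtypeVal],
    fun _ _ => rfl⟩

end TopologicalSpace.Opens

/-- A map into an open subset is a local diffeomorphism if it is one into the ambient manifold. -/
theorem IsLocalDiffeomorphAt.codRestrict {V : Opens N} {f : M → V} {x : M}
    (hf : IsLocalDiffeomorphAt I J k (fun y => (f y : N)) x) :
    IsLocalDiffeomorphAt I J k f x := by
  have hΨ := (V.partialDiffeomorphSubtypeVal (I := J) (k := k) (f x)).symm.isLocalDiffeomorphAt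
    _ _ _ (x := f x) (by simp [Opens.partialDiffeomorphSubtypeVal])
  refine (hf.comp (K := J) (hg := hΨ)).congr_of_eventuallyEq (Eventually.of_forall fun y => ?_)
  exact ((V.openPartialHomeomorphSubtypeCoe ⟨f x⟩).left_inv (by simp)).symm

theorem IsLocalDiffeomorphAt.comp_subtype_val {U : Opens M} {f : M → N} {x : U}
    (hf : IsLocalDiffeomorphAt I J k f x) :
    IsLocalDiffeomorphAt I J k (fun y : U => f y) x :=
  (U.isLocalDiffeomorph_subtype_val x).comp (K := J) (hg := hf)

end LocalDiffeomorph

/-! ### The inverse function theorem and the linear algebra of transverse sections. -/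

section InverseFunction

open Set Filter Topology

variable {E E' : Type*} [NormedAddCommGroup E] [NormedSpace ℝ E]
  [NormedAddCommGroup E'] [NormedSpace ℝ E']

/-- The inverse function theorem, in terms of local diffeomorphisms. -/
theorem isLocalDiffeomorphAt_of_hasFDerivAt [CompleteSpace E] {k : WithTop ℕ∞} (hk : 1 ≤ k)
    {h : E → E'} {a : E} {L : E ≃L[ℝ] E'} (hL : HasFDerivAt h (L : E →L[ℝ] E') a)
    (hh : ∀ᶠ x in 𝓝 a, ContDiffAt ℝ k h x) :
    IsLocalDiffeomorphAt 𝓘(ℝ, E) 𝓘(ℝ, E') k h a := by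
  have hk0 : k ≠ 0 := by
    rintro rfl
    simp at hk
  have ha : ContDiffAt ℝ k h a := hh.self_of_nhds
  let Φ := ha.toOpenPartialHomeomorph h hL hk0
  have hcont : ContinuousAt (fderiv ℝ h) a :=
    (ha.fderiv_right (m := 0) (by simpa using hk)).continuousAt
  -- Invertible operators form an open set, so the derivative stays invertible near a; this gives
  -- smoothness of the inverse on a whole neighbourhood and not only at h(a).
  have hinv : ∀ᶠ x in 𝓝 a, fderiv ℝ h x ∈ range ((↑) : (E ≃L[ℝ] E') → E →L[ℝ] E') :=
    hcont.preimage_mem_nhds (by rw [hL.fderiv]; exact L.nhds)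
  obtain ⟨s, hs, hso, has⟩ := mem_nhds_iff.mp (hh.and hinv)
  refine ⟨{ toPartialEquiv := (Φ.restrOpen s hso).toPartialEquiv
            open_source := (Φ.restrOpen s hso).open_source
            open_target := (Φ.restrOpen s hso).open_target
            contMDiffOn_toFun := fun x hx =>
              ((hs hx.2).1.contMDiffAt).contMDiffWithinAt
            contMDiffOn_invFun := fun y hy => ?_ },
    ⟨ha.mem_toOpenPartialHomeomorph_source hL hk0, has⟩, fun _ _ => rfl⟩
  have hx : Φ.symm y ∈ s := ((Φ.restrOpen s hso).map_target hy).2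
  obtain ⟨hc, L', hL'⟩ := hs hx
  refine ((Φ.contDiffAt_symm (f₀' := L') hy.1 ?_ hc).contMDiffAt).contMDiffWithinAt
  rw [hL']
  exact (hc.differentiableAt hk0).hasFDerivAt

/-- If `(x, v) ↦ S x + T v` is surjective onto a space of the dimension of the space of the `x`,
then for some `A` the map `x ↦ S x + T (A x)` is an isomorphism. -/
theorem LinearMap.exists_bijective_add_comp {K E E' F : Type*} [Field K]
    [AddCommGroup E] [Module K E] [AddCommGroup E'] [Module K E'] [AddCommGroup F] [Module K F]
    [FiniteDimensional K E] [FiniteDimensional K E']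
    (hdim : Module.finrank K E = Module.finrank K E') (S : E →ₗ[K] E') (T : F →ₗ[K] E')
    (hST : ∀ y, ∃ x v, S x + T v = y) :
    ∃ A : E →ₗ[K] F, Function.Bijective (S + T ∘ₗ A) := by
  let q := (LinearMap.range S).mkQ
  have hqS : ∀ x, q (S x) = 0 := fun x => by simp [q]
  have hq : LinearMap.range (q ∘ₗ T) = ⊤ := by
    refine LinearMap.range_eq_top.mpr fun z => ?_
    obtain ⟨y, rfl⟩ := (LinearMap.range S).mkQ_surjective z
    obtain ⟨x, v, rfl⟩ := hST y
    exact ⟨v, by simp [q]⟩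
  -- Modulo the range of S, T alone is surjective, so the cokernel of S lifts through T.
  obtain ⟨r, hr⟩ := (q ∘ₗ T).exists_rightInverse_of_surjective hq
  have hfin : Module.finrank K (LinearMap.ker S) =
      Module.finrank K (E' ⧸ LinearMap.range S) := by
    have h₁ := S.finrank_range_add_finrank_ker
    have h₂ := (LinearMap.range S).finrank_quotient_add_finrank
    omega
  let e := LinearEquiv.ofFinrankEq _ _ hfin
  obtain ⟨p, hp⟩ := (LinearMap.ker S).subtype.exists_leftInverse_of_injective (by simp)
  -- A projects onto ker S, identifies ker S with coker S (equal dimensions by rank-nullity), and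
  -- lifts to F: T ∘ A supplies exactly the directions that S misses.
  refine ⟨r ∘ₗ e.toLinearMap ∘ₗ p, ?_⟩
  have hinj : Function.Injective (S + T ∘ₗ r ∘ₗ e.toLinearMap ∘ₗ p) := by
    refine (injective_iff_map_eq_zero _).mpr fun x hx => ?_
    have h₁ : S x + T (r (e (p x))) = 0 := hx
    -- Applying q to h₁ kills S x and leaves e (p x) = 0. Hence p x = 0 and x ∈ ker S, where p is
    -- the identity.
    have h₂ : q (T (r (e (p x)))) = e (p x) := LinearMap.congr_fun hr _
    have h₃ : e (p x) = 0 := by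
      rw [← h₂, ← zero_add (q _), ← hqS x, ← map_add, h₁, map_zero, hqS]
    have h₄ : S x = 0 := by simpa [h₃] using h₁
    have h₅ : p x = ⟨x, h₄⟩ := LinearMap.congr_fun hp ⟨x, h₄⟩
    have h₆ : p x = 0 := by simpa using h₃
    exact congrArg Subtype.val (h₅.symm.trans h₆)
  exact ⟨hinj, (LinearMap.injective_iff_surjective_of_finrank_eq_finrank hdim).mp hinj⟩

end InverseFunction
-- Submersions in adapted coordinates, and their affine local sections.
section Submersion

open Set Filter Topology

variable {E : Type w} {E' : Type*} [NormedAddCommGroup E] [NormedSpace ℝ E]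
  [NormedAddCommGroup E'] [NormedSpace ℝ E']
  {M N : Type*} [TopologicalSpace M] [ChartedSpace E M]
  [TopologicalSpace N] [ChartedSpace E' N]

/-- Local coordinates at `x` in which `f` is the projection `(u, v) ↦ u`. -/
structure SubmersionCoordinates (F : Type*) [NormedAddCommGroup F] [NormedSpace ℝ F]
    (f : M → N) (x : M) where
  param : E' × F → M
  chart : N → E'
  fiberPt : F
  param_apply : param (chart (f x), fiberPt) = x
  isLocalDiffeomorphAt_param :
    IsLocalDiffeomorphAt 𝓘(ℝ, E' × F) 𝓘(ℝ, E) ∞ param (chart (f x), fiberPt)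
  isLocalDiffeomorphAt_chart : IsLocalDiffeomorphAt 𝓘(ℝ, E') 𝓘(ℝ, E') ∞ chart (f x)
  chart_param : ∀ᶠ p in 𝓝 (chart (f x), fiberPt), chart (f (param p)) = p.1
  continuousAt : ContinuousAt f x

/-- A submersion has charts φ, ψ and a linear equivalence e with ψ ∘ f ∘ φ⁻¹ = pr₁ ∘ e; inverting φ
and e gives `param`. Keeping only what holds near the point avoids tracking chart domains later. -/
theorem Manifold.IsSubmersionAt.exists_submersionCoordinates
    [IsManifold 𝓘(ℝ, E) ∞ M] [IsManifold 𝓘(ℝ, E') ∞ N] {f : M → N} {x : M}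
    (hf : Manifold.IsSubmersionAt 𝓘(ℝ, E) 𝓘(ℝ, E') ∞ f x) :
    ∃ (F : Type w) (_ : NormedAddCommGroup F) (_ : NormedSpace ℝ F),
      Nonempty (SubmersionCoordinates (E := E) (E' := E') F f x) := by
  have hcont : ContinuousAt f x := hf.contMDiffAt.continuousAt
  obtain ⟨F, _, _, hF⟩ := hf
  have hφ := hF.domChart_mem_maximalAtlas
  have hψ := hF.codChart_mem_maximalAtlas
  have hx := hF.mem_domChart_source
  have hw := hF.writtenInCharts
  set φ := hF.domChart
  set ψ := hF.codChart
  set e := hF.equiv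
  have hw' : ∀ z ∈ φ.target, ψ (f (φ.symm z)) = (e z).1 := fun z hz => hw (by simpa using hz)
  have hu : ψ (f x) = (e (φ x)).1 := by
    rw [← hw' _ (φ.map_source hx), φ.left_inv hx]
  have hp : (ψ (f x), (e (φ x)).2) = e (φ x) := Prod.ext hu rfl
  refine ⟨F, inferInstance, inferInstance,
    ⟨⟨fun p => φ.symm (e.symm p), ψ, (e (φ x)).2, ?_, ?_, ?_, ?_, hcont⟩⟩⟩
  · rw [hp, e.symm_apply_apply, φ.left_inv hx]
  · rw [hp]
    refine IsLocalDiffeomorphAt.comp (f := e.symm) (g := φ.symm)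
      (J := 𝓘(ℝ, E)) (hf := e.symm.toDiffeomorph.isLocalDiffeomorph _) (hg := ?_)
    rw [e.symm_apply_apply]
    refine (φ.isLocalDiffeomorphAt_of_mem_maximalAtlas hφ hx).of_rightInverse (φ.left_inv hx) ?_ ?_
    · exact φ.continuousAt_symm (φ.map_source hx)
    · filter_upwards [φ.open_target.mem_nhds (φ.map_source hx)] with z hz using φ.right_inv hz
  · exact ψ.isLocalDiffeomorphAt_of_mem_maximalAtlas hψ hF.mem_codChart_source
  · rw [hp]
    have : e.symm ⁻¹' φ.target ∈ 𝓝 (e (φ x)) :=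
      e.symm.continuous.continuousAt.preimage_mem_nhds
        (by rw [e.symm_apply_apply]; exact φ.open_target.mem_nhds (φ.map_source hx))
    filter_upwards [this] with p hpt
    rw [hw' _ hpt, e.apply_symm_apply]

namespace SubmersionCoordinates

variable {F : Type*} [NormedAddCommGroup F] [NormedSpace ℝ F] {f : M → N} {x : M}
  (c : SubmersionCoordinates (E := E) (E' := E') F f x)

/-- The local section through `x` which, in the coordinates `c`, is affine with linear
part `A`. -/
def localSection (A : E' →L[ℝ] F) (y : N) : M :=
  c.param (c.chart y, c.fiberPt + A (c.chart y - c.chart (f x)))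

theorem localSection_apply (A : E' →L[ℝ] F) : c.localSection A (f x) = x := by
  simp [localSection, c.param_apply]

theorem tendsto_coordinates (A : E' →L[ℝ] F) :
    Tendsto (fun y => (c.chart y, c.fiberPt + A (c.chart y - c.chart (f x))))
      (𝓝 (f x)) (𝓝 (c.chart (f x), c.fiberPt)) := by
  have hψ : ContinuousAt c.chart (f x) := c.isLocalDiffeomorphAt_chart.contMDiffAt.continuousAt
  have hlin : Continuous fun u : E' => (u, c.fiberPt + A (u - c.chart (f x))) := by fun_prop
  have h := (hlin.continuousAt (x := c.chart (f x))).comp hψ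
  simpa [ContinuousAt, Function.comp_def] using h

theorem contMDiffAt_localSection (A : E' →L[ℝ] F) :
    ∀ᶠ y in 𝓝 (f x), ContMDiffAt 𝓘(ℝ, E') 𝓘(ℝ, E) ∞ (c.localSection A) y := by
  have hlin : ContDiff ℝ ∞ fun u : E' => (u, c.fiberPt + A (u - c.chart (f x))) := by fun_prop
  filter_upwards [c.isLocalDiffeomorphAt_chart.eventually,
    (c.tendsto_coordinates A).eventually c.isLocalDiffeomorphAt_param.eventually] with y hy hy'
  exact hy'.contMDiffAt.comp y ((hlin.contMDiff _).comp y hy.contMDiffAt)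

/-- The coordinates give only chart (f (σ y)) = chart y. Since `chart` is injective merely near f x,
continuity is needed to keep f (σ y) there. -/
theorem apply_localSection (A : E' →L[ℝ] F) :
    ∀ᶠ y in 𝓝 (f x), f (c.localSection A y) = y := by
  have hσ : ContinuousAt (c.localSection A) (f x) :=
    (c.contMDiffAt_localSection A).self_of_nhds.continuousAt
  obtain ⟨s, hs, hinj⟩ := c.isLocalDiffeomorphAt_chart.eventually_eq_of_apply_eq
  have hfσ : Tendsto (fun y => f (c.localSection A y)) (𝓝 (f x)) (𝓝 (f x)) := by
    have h := c.continuousAt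
    rw [← c.localSection_apply A] at h
    have h' := ContinuousAt.comp h hσ
    simpa [ContinuousAt, Function.comp_def, c.localSection_apply A] using h'
  filter_upwards [hs, hfσ hs,
    (c.tendsto_coordinates A).eventually c.chart_param] with y hy hy' hy''
  exact hinj _ hy' _ hy hy''

end SubmersionCoordinates

end Submersion
-- Common transverse sections of two submersions.
section Bisection

open Set Filter Topology

variable {E E' : Type*} [NormedAddCommGroup E] [NormedSpace ℝ E]
  [NormedAddCommGroup E'] [NormedSpace ℝ E']
  {M N N' : Type*} [TopologicalSpace M] [ChartedSpace E M]
  [TopologicalSpace N] [ChartedSpace E' N] [TopologicalSpace N'] [ChartedSpace E' N']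

/-- A smooth map with a smooth local right inverse has surjective derivative. -/
theorem surjective_fderiv_of_eventually_rightInverse {h : E → E'} {q : E' → E} {a : E} {b : E'}
    (hq : DifferentiableAt ℝ q b) (hqb : q b = a) (hh : DifferentiableAt ℝ h a)
    (hid : ∀ᶠ y in 𝓝 b, h (q y) = y) (y : E') : fderiv ℝ h a (fderiv ℝ q b y) = y := by
  subst hqb
  have h₁ : HasFDerivAt (h ∘ q) ((fderiv ℝ h (q b)).comp (fderiv ℝ q b)) b :=
    hh.hasFDerivAt.comp b hq.hasFDerivAt
  have h₂ : HasFDerivAt (h ∘ q) (ContinuousLinearMap.id ℝ E') b :=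
    (hasFDerivAt_id b).congr_of_eventuallyEq hid
  exact DFunLike.congr_fun (h₁.unique h₂) y

namespace SubmersionCoordinates

variable {F F' : Type*} [NormedAddCommGroup F] [NormedSpace ℝ F]
  [NormedAddCommGroup F'] [NormedSpace ℝ F'] {f : M → N} {f' : M → N'} {x : M}

/-- In coordinates, the derivative of a submersion is surjective. -/
theorem surjective_fderiv (c : SubmersionCoordinates (E := E) (E' := E') F f x)
    (d : SubmersionCoordinates (E := E) (E' := E') F' f' x)
    (hf' : ContMDiffAt 𝓘(ℝ, E) 𝓘(ℝ, E') ∞ f' x) :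
    Function.Surjective
      (fderiv ℝ (fun p => d.chart (f' (c.param p))) (c.chart (f x), c.fiberPt)) := by
  have hP := c.isLocalDiffeomorphAt_param
  have hD := d.isLocalDiffeomorphAt_chart
  have hPx : hP.localInverse x = (c.chart (f x), c.fiberPt) := by
    have h := hP.localInverse_left_inv hP.localInverse_mem_target
    rwa [c.param_apply] at h
  have hDx : hD.localInverse (d.chart (f' x)) = f' x :=
    hD.localInverse_left_inv hD.localInverse_mem_target
  have hPs : ContMDiffAt 𝓘(ℝ, E) 𝓘(ℝ, E' × F) ∞ hP.localInverse x := by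
    have h := hP.localInverse_contMDiffAt
    rwa [c.param_apply] at h
  have hPr : ∀ᶠ z in 𝓝 x, c.param (hP.localInverse z) = z := by
    have h := hP.localInverse_eventuallyEq_right
    rwa [c.param_apply] at h
  -- Any section of f' through x, read in coordinates, is a right inverse of d.chart ∘ f' ∘ c.param;
  -- linear part 0 is the simplest choice.
  have hτ := (d.contMDiffAt_localSection 0).self_of_nhds
  have hDs := hD.localInverse_contMDiffAt
  have hτD : ContMDiffAt 𝓘(ℝ, E') 𝓘(ℝ, E) ∞ (d.localSection 0 ∘ hD.localInverse)
      (d.chart (f' x)) := by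
    refine ContMDiffAt.comp _ ?_ hDs
    rwa [hDx]
  have hτx : (d.localSection 0 ∘ hD.localInverse) (d.chart (f' x)) = x := by
    rw [Function.comp_apply, hDx, d.localSection_apply]
  have hq : ContMDiffAt 𝓘(ℝ, E') 𝓘(ℝ, E' × F) ∞
      (hP.localInverse ∘ d.localSection 0 ∘ hD.localInverse) (d.chart (f' x)) := by
    refine ContMDiffAt.comp _ ?_ hτD
    rwa [hτx]
  have hh : ContMDiffAt 𝓘(ℝ, E' × F) 𝓘(ℝ, E') ∞ (fun p => d.chart (f' (c.param p)))
      (c.chart (f x), c.fiberPt) := by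
    refine hD.contMDiffAt.comp_of_eq (g := d.chart) (f := fun p => f' (c.param p)) ?_
      (by rw [c.param_apply])
    exact hf'.comp_of_eq (g := f') hP.contMDiffAt c.param_apply
  have hid : ∀ᶠ y in 𝓝 (d.chart (f' x)),
      d.chart (f' (c.param ((hP.localInverse ∘ d.localSection 0 ∘ hD.localInverse) y))) = y := by
    have h₁ := hτD.continuousAt.tendsto
    rw [hτx] at h₁
    have h₂ := hDs.continuousAt.tendsto
    rw [hDx] at h₂
    filter_upwards [hD.localInverse_eventuallyEq_right, h₁.eventually hPr,
      h₂.eventually (d.apply_localSection 0)] with y hy hy₁ hy₂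
    rw [Function.comp_apply, hy₁, Function.comp_apply, hy₂]
    exact hy
  intro y
  refine ⟨_, surjective_fderiv_of_eventually_rightInverse
    (hq.contDiffAt.differentiableAt (by simp)) ?_ (hh.contDiffAt.differentiableAt (by simp)) hid y⟩
  rw [Function.comp_apply, hτx, hPx]

/-- Choosing the slope A of an affine section of f makes the derivative S + T ∘ A of its composite
with f' bijective, where S and T are the partial derivatives of f' in coordinates. Both base
manifolds are modelled on E', which gives the equality of dimensions. -/
theorem exists_isLocalDiffeomorphAt_comp_localSection [FiniteDimensional ℝ E']
    (c : SubmersionCoordinates (E := E) (E' := E') F f x)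
    (d : SubmersionCoordinates (E := E) (E' := E') F' f' x)
    (hf' : ContMDiff 𝓘(ℝ, E) 𝓘(ℝ, E') ∞ f') :
    ∃ A : E' →L[ℝ] F,
      IsLocalDiffeomorphAt 𝓘(ℝ, E') 𝓘(ℝ, E') ∞ (fun y => f' (c.localSection A y)) (f x) := by
  have := FiniteDimensional.complete ℝ E'
  have hD := d.isLocalDiffeomorphAt_chart
  let h : E' × F → E' := fun p => d.chart (f' (c.param p))
  let p₀ : E' × F := (c.chart (f x), c.fiberPt)
  have hp₀ : c.param p₀ = x := c.param_apply
  have hsurj : Function.Surjective (fderiv ℝ h p₀) := c.surjective_fderiv d hf'.contMDiffAt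
  have htend : Tendsto (fun p => f' (c.param p)) (𝓝 p₀) (𝓝 (f' x)) := by
    have h₁ := hf'.continuous.continuousAt.comp
      (c.isLocalDiffeomorphAt_param.contMDiffAt.continuousAt)
    simpa [ContinuousAt, Function.comp_def, c.param_apply] using h₁
  have hh : ∀ᶠ p in 𝓝 p₀, ContDiffAt ℝ ∞ h p := by
    filter_upwards [c.isLocalDiffeomorphAt_param.eventually, htend.eventually hD.eventually]
      with p hp hp'
    refine ContMDiffAt.contDiffAt ?_
    exact hp'.contMDiffAt.comp (g := d.chart) (f := fun p => f' (c.param p)) p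
      (hf'.contMDiffAt.comp (g := f') p hp.contMDiffAt)
  obtain ⟨A, hA⟩ := LinearMap.exists_bijective_add_comp rfl
    ((fderiv ℝ h p₀).toLinearMap ∘ₗ LinearMap.inl ℝ E' F)
    ((fderiv ℝ h p₀).toLinearMap ∘ₗ LinearMap.inr ℝ E' F) (fun y => by
      obtain ⟨p, hp⟩ := hsurj y
      refine ⟨p.1, p.2, ?_⟩
      rw [← hp]
      simp [← map_add])
  let B : E' →L[ℝ] F := A.toContinuousLinearMap
  let L : E' ≃L[ℝ] E' := (LinearEquiv.ofBijective _ hA).toContinuousLinearEquiv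
  -- The section in coordinates: the affine graph through `p₀` with slope B.
  let r : E' → E' × F := fun u => (u, c.fiberPt + B (u - c.chart (f x)))
  have hr : ContDiff ℝ ∞ r := by fun_prop
  have hr₀ : r (c.chart (f x)) = p₀ := by simp [r, p₀]
  have hr' : HasFDerivAt r ((ContinuousLinearMap.id ℝ E').prod B) (c.chart (f x)) := by
    refine (hasFDerivAt_id _).prodMk ?_
    exact (B.hasFDerivAt.comp (c.chart (f x)) ((hasFDerivAt_id _).sub_const _)).const_add _
  have hk : HasFDerivAt (h ∘ r) (L : E' →L[ℝ] E') (c.chart (f x)) := by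
    have h₁ : HasFDerivAt h (fderiv ℝ h p₀) (r (c.chart (f x))) := by
      rw [hr₀]
      exact (hh.self_of_nhds.differentiableAt (by simp)).hasFDerivAt
    convert h₁.comp _ hr' using 1
    ext u
    simp [L, B, ← map_add]
  have hsmooth : ∀ᶠ u in 𝓝 (c.chart (f x)), ContDiffAt ℝ ∞ (h ∘ r) u := by
    have h₁ := hr.continuous.continuousAt (x := c.chart (f x))
    rw [ContinuousAt, hr₀] at h₁
    filter_upwards [h₁.eventually hh] with u hu using hu.comp u hr.contDiffAt
  have hloc := isLocalDiffeomorphAt_of_hasFDerivAt (by simp) hk hsmooth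
  have hval : (h ∘ r) (c.chart (f x)) = d.chart (f' x) := by
    simp only [Function.comp_apply, hr₀, h, hp₀]
  refine ⟨B, ?_⟩
  -- Here h ∘ r ∘ c.chart is d.chart ∘ f' ∘ σ, with σ the local section; the local inverse of
  -- d.chart then removes the outer chart.
  have h₁ := c.isLocalDiffeomorphAt_chart.comp (K := 𝓘(ℝ, E')) (hg := hloc)
  have h₂ : IsLocalDiffeomorphAt 𝓘(ℝ, E') 𝓘(ℝ, E') ∞ hD.localInverse
      (((h ∘ r) ∘ c.chart) (f x)) := by
    rw [Function.comp_apply, hval]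
    exact hD.localInverse_isLocalDiffeomorphAt
  refine (h₁.comp (K := 𝓘(ℝ, E')) (hg := h₂)).congr_of_eventuallyEq ?_
  filter_upwards [((c.tendsto_coordinates B).eventually
    (htend.eventually hD.localInverse_eventuallyEq_left))] with y hy
  exact hy.symm

end SubmersionCoordinates

/-- Through every point passes a common smooth local section, transverse to the fibres of both,
of two submersions onto manifolds of the same dimension. -/
theorem Manifold.IsSubmersion.exists_localSection_isLocalDiffeomorphAt [FiniteDimensional ℝ E']
    [IsManifold 𝓘(ℝ, E) ∞ M] [IsManifold 𝓘(ℝ, E') ∞ N] [IsManifold 𝓘(ℝ, E') ∞ N']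
    {f : M → N} {f' : M → N'} (hf : Manifold.IsSubmersion 𝓘(ℝ, E) 𝓘(ℝ, E') ∞ f)
    (hf' : Manifold.IsSubmersion 𝓘(ℝ, E) 𝓘(ℝ, E') ∞ f') (x : M) :
    ∃ σ : N → M, σ (f x) = x ∧
      (∀ᶠ y in 𝓝 (f x), ContMDiffAt 𝓘(ℝ, E') 𝓘(ℝ, E) ∞ σ y) ∧
      (∀ᶠ y in 𝓝 (f x), f (σ y) = y) ∧
      IsLocalDiffeomorphAt 𝓘(ℝ, E') 𝓘(ℝ, E') ∞ (fun y => f' (σ y)) (f x) := by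
  obtain ⟨F, _, _, ⟨c⟩⟩ := (hf.isSubmersionAt x).exists_submersionCoordinates
  obtain ⟨F', _, _, ⟨d⟩⟩ := (hf'.isSubmersionAt x).exists_submersionCoordinates
  obtain ⟨A, hA⟩ := c.exists_isLocalDiffeomorphAt_comp_localSection d hf'.contMDiff
  exact ⟨c.localSection A, c.localSection_apply A, c.contMDiffAt_localSection A,
    c.apply_localSection A, hA⟩

end Bisection
-- The étale structure of a smooth groupoid.
namespace SmoothGroupoid

open Set Filter Topology

variable {n m : ℕ} {G₀ : Type u} {G₁ : Type v}
  [TopologicalSpace G₀] [ChartedSpace (EuclideanSpace ℝ (Fin n)) G₀]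
  [TopologicalSpace G₁] [ChartedSpace (EuclideanSpace ℝ (Fin m)) G₁]
  (G : SmoothGroupoid n m G₀ G₁)

theorem inv_inv (g : G₁) : G.inv (G.inv g) = g := by
  -- The two bracketings of (g⁻¹)⁻¹ g⁻¹ g evaluate to g and to (g⁻¹)⁻¹.
  have h₁ := G.mul_assoc (G.inv (G.inv g)) (G.inv g) g (G.s_inv _) (G.s_inv _)
  have h₂ := G.mul_one (G.inv (G.inv g))
  have h₃ := G.one_mul g
  rw [G.s_inv, G.t_inv] at h₂
  rwa [G.inv_mul, G.inv_mul, h₂, G.s_inv, h₃, eq_comm] at h₁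

/-- The inversion of arrows, as a diffeomorphism. -/
def invDiffeomorph : Diffeomorph (𝓡 m) (𝓡 m) G₁ G₁ ∞ where
  toFun := G.inv
  invFun := G.inv
  left_inv := G.inv_inv
  right_inv := G.inv_inv
  contMDiff_toFun := G.smooth_inv
  contMDiff_invFun := G.smooth_inv

theorem isLocalDiffeomorph_target (hs : IsLocalDiffeomorph (𝓡 m) (𝓡 n) ∞ G.s) :
    IsLocalDiffeomorph (𝓡 m) (𝓡 n) ∞ G.t := by
  have h : G.t = G.s ∘ G.inv := funext fun g => (G.s_inv g).symm
  rw [h]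
  exact fun g => (G.invDiffeomorph.isLocalDiffeomorph g).comp (K := 𝓡 n) (hg := hs _)

/-- In an étale groupoid, every smooth local section of the source map is a morphism. -/
theorem exists_eHom_of_isLocalDiffeomorph (hs : IsLocalDiffeomorph (𝓡 m) (𝓡 n) ∞ G.s)
    (U V : G.EObj) (σ : U.opens → G₁) (hσ : ContMDiff (𝓡 n) (𝓡 m) ∞ σ)
    (hsσ : ∀ x, G.s (σ x) = x) (htσ : ∀ x, G.t (σ x) ∈ V.opens) :
    ∃ φ : G.EHom U V, φ.toFun = σ := by
  refine ⟨⟨σ, hσ, hsσ, htσ, fun x => IsLocalDiffeomorphAt.codRestrict ?_⟩, rfl⟩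
  have hx := hs (σ x)
  -- By continuity σ stays near σ x, where s is injective, so s ∘ σ = id makes σ the local inverse
  -- of s.
  have hloc : IsLocalDiffeomorphAt (𝓡 n) (𝓡 m) ∞ σ x := by
    have hinv := hx.localInverse_isLocalDiffeomorphAt
    rw [hsσ x] at hinv
    refine hinv.comp_subtype_val.congr_of_eventuallyEq ?_
    filter_upwards [hσ.continuous.continuousAt.preimage_mem_nhds
      (hx.localInverse.open_target.mem_nhds hx.localInverse_mem_target)] with y hy
    rw [← hsσ y, hx.localInverse_left_inv hy]
  exact hloc.comp (K := 𝓡 n) (hg := G.isLocalDiffeomorph_target hs (σ x))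

/-- Through every arrow passes a morphism of `E(G)`. -/
theorem exists_eHom_through [IsManifold (𝓡 n) ∞ G₀] [IsManifold (𝓡 m) ∞ G₁] (g : G₁) :
    ∃ (U : G.EObj) (σ : G.EHom U ⟨⊤⟩) (x : U.opens), (x : G₀) = G.s g ∧ σ.toFun x = g := by
  obtain ⟨σ, hσg, hσ, hs, ht⟩ :=
    G.submersion_s.exists_localSection_isLocalDiffeomorphAt G.submersion_t g
  -- Being smooth, a section of s, and étale after t are all open conditions, so one U serves for
  -- all three.
  obtain ⟨U, hU, hUo, hgU⟩ := mem_nhds_iff.mp ((hσ.and hs).and ht.eventually)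
  refine ⟨⟨⟨U, hUo⟩⟩, ⟨fun x => σ x, fun x => ?_, fun x => (hU x.2).1.2, fun x => trivial,
    fun x => IsLocalDiffeomorphAt.codRestrict ?_⟩, ⟨G.s g, hgU⟩, rfl, hσg⟩
  · exact contMDiffAt_subtype_iff.mpr (hU x.2).1.1
  · exact (hU x.2).2.comp_subtype_val

/-- The inclusion of an open subset, as a morphism of `E(G)`: the section `x ↦ 1_x`. -/
def inclusionHom {U V : G.EObj} (h : U.opens ≤ V.opens) : G.EHom U V where
  toFun x := G.one x
  smooth := G.smooth_one.comp contMDiff_subtype_val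
  source_eq x := G.s_one x
  target_mem x := by rw [G.t_one]; exact h x.2
  etale x := by
    refine IsLocalDiffeomorphAt.codRestrict ?_
    simp only [G.t_one]
    exact U.opens.isLocalDiffeomorph_subtype_val x

/-- Every morphism `σ` of `E(G)` has a local inverse near each point, given by the inverses of
the arrows `σ(x)`. -/
theorem exists_localInverse {U V : G.EObj} (σ : G.EHom U V) (x : U.opens) :
    ∃ (W : Opens V.opens) (K : G.EObj) (τ : G.EHom K U)
      (e : Diffeomorph (𝓡 n) (𝓡 n) K.opens W ∞) (y : K.opens),
      (e y : V.opens) = σ.map x ∧ τ.map y = x ∧ ∀ z, σ.map (τ.map z) = e z := by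
  obtain ⟨Φ, hx, hΦ⟩ := σ.etale x
  let W : Opens V.opens := ⟨Φ.target, Φ.open_target⟩
  -- K and W are the same set of points, the target of Φ, seen as open in G₀ and in V; e is the
  -- identity on points.
  let K : G.EObj := ⟨⟨Subtype.val '' (W : Set V.opens),
    V.opens.isOpen.isOpenMap_subtype_val _ W.isOpen⟩⟩
  have hKV : ∀ z : K.opens, (z : G₀) ∈ V.opens := by
    rintro ⟨_, w, _, rfl⟩
    exact w.2
  have hKW : ∀ z : K.opens, (⟨z, hKV z⟩ : V.opens) ∈ W := by
    rintro ⟨_, w, hw, rfl⟩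
    exact hw
  have hι : IsLocalDiffeomorph (𝓡 n) (𝓡 n) ∞ (fun z : K.opens => (⟨z, hKV z⟩ : V.opens)) :=
    fun z => (K.opens.isLocalDiffeomorph_subtype_val z).codRestrict
      (f := fun z : K.opens => (⟨z, hKV z⟩ : V.opens))
  have hι' : IsLocalDiffeomorph (𝓡 n) (𝓡 n) ∞
      (fun z : K.opens => (⟨⟨z, hKV z⟩, hKW z⟩ : W)) :=
    fun z => (hι z).codRestrict (f := fun z : K.opens => (⟨⟨z, hKV z⟩, hKW z⟩ : W))
  have hκ : IsLocalDiffeomorph (𝓡 n) (𝓡 n) ∞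
      (fun w : W => (⟨w.1.1, w.1, w.2, rfl⟩ : K.opens)) := fun w => by
    refine IsLocalDiffeomorphAt.codRestrict ?_
    exact (V.opens.isLocalDiffeomorph_subtype_val w.1).comp_subtype_val
  let e : Diffeomorph (𝓡 n) (𝓡 n) K.opens W ∞ :=
    { toFun := fun z => ⟨⟨z, hKV z⟩, hKW z⟩
      invFun := fun w => ⟨w.1.1, w.1, w.2, rfl⟩
      left_inv := fun _ => rfl
      right_inv := fun _ => rfl
      contMDiff_toFun := hι'.contMDiff
      contMDiff_invFun := hκ.contMDiff }
  let ρ : K.opens → U.opens := fun z => Φ.symm ⟨z, hKV z⟩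
  have hρ : IsLocalDiffeomorph (𝓡 n) (𝓡 n) ∞ ρ := fun z =>
    (hι z).comp (K := 𝓡 n) (hg := Φ.symm.isLocalDiffeomorphAt _ _ _ (hKW z))
  have hσρ : ∀ z, σ.map (ρ z) = ⟨z, hKV z⟩ := fun z =>
    (hΦ (Φ.map_target (hKW z))).trans (Φ.right_inv (hKW z))
  have htgt : ∀ z, G.t (G.inv (σ.toFun (ρ z))) = ρ z := fun z => by
    rw [G.t_inv, σ.source_eq]
  -- The arrow σ(ρ z) runs from ρ z to z, so its inverse has source z and target ρ z; thus t ∘ τ =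
  -- ρ.
  let τ : G.EHom K U :=
    { toFun := fun z => G.inv (σ.toFun (ρ z))
      smooth := G.smooth_inv.comp (σ.smooth.comp hρ.contMDiff)
      source_eq := fun z => by
        rw [G.s_inv]
        exact congrArg Subtype.val (hσρ z)
      target_mem := fun z => by
        rw [htgt]
        exact (ρ z).2
      etale := fun z => (hρ z).congr_of_eventuallyEq
        (Eventually.of_forall fun z => Subtype.ext (htgt z)) }
  have hτ : ∀ z, τ.map z = ρ z := fun z => Subtype.ext (htgt z)
  have hΦx : σ.map x = Φ x := hΦ hx
  have hW : σ.map x ∈ W := by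
    rw [hΦx]
    exact Φ.map_source hx
  refine ⟨W, K, τ, e, ⟨σ.map x, σ.map x, hW, rfl⟩, rfl, ?_, fun z => ?_⟩
  · rw [hτ]
    change Φ.symm (σ.map x) = x
    rw [hΦx]
    exact Φ.left_inv hx
  · rw [hτ, hσρ]
    rfl

variable [IsManifold (𝓡 n) ∞ G₀] [T2Space G₀]

theorem isLocallyInvertible_proj : IsLocallyInvertible G.proj := fun _ _ f x => by
  obtain ⟨W, K, τ, e, y, h⟩ := G.exists_localInverse f x
  exact ⟨K, τ, W, e, y, h⟩

/-- Fullness is built into `etaleMaps`, which admits only maps of the form t ∘ σ. -/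
theorem full_proj : G.proj.Full where
  map_surjective := by
    rintro U V φ
    obtain ⟨σ, hσ⟩ := φ.property
    refine ⟨σ, WideSubcategory.hom_ext _ (InducedCategory.hom_ext ?_)⟩
    exact CostructuredArrow.hom_ext _ _ (EtMan.Hom.ext (funext fun x => (hσ x).symm))

/-- The object G₀ itself controls every cocone: its component determines the others by restriction
(`hincl`) and is constant on orbits (`hrel`). -/
theorem nonempty_isColimit_chartCocone [IsManifold (𝓡 m) ∞ G₁] :
    Nonempty (IsColimit (chartCocone G.proj)) := by
  let top : G.EObj := ⟨⊤⟩
  have hincl : ∀ (c : Cocone (domainFunctor G.proj ⋙ EtMan.forget.{u} n)) (U : G.EObj)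
      (x : U.opens), c.ι.app top (⟨x, trivial⟩ : top.opens) = c.ι.app U x := fun c U x => by
    have h := ConcreteCategory.congr_hom (c.w (G.inclusionHom (V := top) le_top)) x
    refine Eq.trans ?_ h
    refine congrArg (c.ι.app top) ?_
    exact Subtype.ext (G.t_one x).symm
  have hrel : ∀ (c : Cocone (domainFunctor G.proj ⋙ EtMan.forget.{u} n)) (x y : G₀),
      (∃ g, G.s g = x ∧ G.t g = y) →
      c.ι.app top (⟨x, trivial⟩ : top.opens) = c.ι.app top (⟨y, trivial⟩ : top.opens) := by
    rintro c _ _ ⟨g, rfl, rfl⟩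
    obtain ⟨U, σ, x, hx, hg⟩ := G.exists_eHom_through g
    -- Compatibility with σ equates the G₀-component at t(g) with the U-component at x; `hincl`
    -- turns the latter into the G₀-component at s(g).
    have h := ConcreteCategory.congr_hom (c.w (show U ⟶ top from σ)) x
    have h₁ : σ.map x = (⟨G.t g, trivial⟩ : top.opens) := Subtype.ext (congrArg G.t hg)
    have h₂ : c.ι.app top (σ.map x) = c.ι.app U x := h
    rw [h₁, ← hincl c U x] at h₂
    simpa only [← hx] using h₂.symm
  refine ⟨{ desc := fun c => TypeCat.ofHom
              (Quot.lift (fun x => c.ι.app top (⟨x, trivial⟩ : top.opens)) (hrel c))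
            fac := fun c U => ConcreteCategory.hom_ext _ _ fun x => hincl c U x
            uniq := fun c φ hφ => ConcreteCategory.hom_ext _ _ fun z => ?_ }⟩
  obtain ⟨x, rfl⟩ := Quot.exists_rep z
  exact ConcreteCategory.congr_hom (hφ top) (⟨x, trivial⟩ : top.opens)

end SmoothGroupoid

theorem proposition3p1 {n m : ℕ} {G₀ : Type u} {G₁ : Type v}
    [TopologicalSpace G₀] [ChartedSpace (EuclideanSpace ℝ (Fin n)) G₀]
    [IsManifold (𝓡 n) ∞ G₀] [T2Space G₀]
    [TopologicalSpace G₁] [ChartedSpace (EuclideanSpace ℝ (Fin m)) G₁]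
    [IsManifold (𝓡 m) ∞ G₁]
    (G : SmoothGroupoid n m G₀ G₁) :
    -- `E(G)` is an étale structure on the orbit set, and it is locally invertible
    IsEtaleStructure G.chart G.etaleMaps G.proj ∧
    IsLocallyInvertible G.proj ∧
    -- through every arrow of `G` passes a morphism of `E(G)`
    (∀ g : G₁, ∃ (U V : G.EObj) (σ : G.EHom U V) (x : U.opens),
      (x : G₀) = G.s g ∧ σ.toFun x = g) ∧
    -- if `G` is étale, every smooth local section of the source map is a morphism of `E(G)`
    (IsLocalDiffeomorph (𝓡 m) (𝓡 n) ∞ G.s →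
      ∀ (U V : G.EObj) (σ : U.opens → G₁), ContMDiff (𝓡 n) (𝓡 m) ∞ σ →
        (∀ x, G.s (σ x) = x) → (∀ x, G.t (σ x) ∈ V.opens) →
        ∃ φ : G.EHom U V, φ.toFun = σ) := by
  refine ⟨⟨fun _ => rfl, G.full_proj, G.nonempty_isColimit_chartCocone⟩,
    G.isLocallyInvertible_proj, fun g => ?_, G.exists_eHom_of_isLocalDiffeomorph⟩
  obtain ⟨U, σ, x, h⟩ := G.exists_eHom_through g
  exact ⟨U, _, σ, x, h⟩
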